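/- Let $\widetilde F$ be Thompson's group $F$ realized as the group of all orientation preserving piecewise linear homeomorphisms $g$ of $\mathbb R$ with finitely many break points, all of them dyadic rational, whose slopes are integer powers of $2$, and such that $g(\gamma)=\gamma+C_-(g)$ near $-\infty$ and $g(\gamma)=\gamma+C_+(g)$ near $+\infty$ with integers $C_\pm(g)$. The multiplication is $(g_1g_2)(\gamma)=g_2(g_1(\gamma))$, so that $\widetilde F$ acts on the right on the set of dyadic rationals $\Gamma=\mathbb Z[\tfrac12]$ by $\gamma.g=g(\gamma)$. For $g\in\widetilde F$ let $$C_g(\gamma)=\log_2 g'(\gamma+0)-\log_2 g'(\gamma-0)\in\mathbb Z,\qquad \gamma\in\Gamma,$$ and let $\widetilde F$ act on the left on the space $\mathrm{Fun}(\Gamma,\mathbb Z)$ of all $\mathbb Z$-valued configurations on $\Gamma$ (with the product $\sigma$-algebra) by $(g\cdot C)(\gamma)=C_g(\gamma)+C(\gamma.g)$. For a probability measure $\mu$ on a countable group $G$, let $\mathbf P_\theta$ be the law on $G^{\mathbb Z_+}$ of the path $g_n=g_0h_1\cdots h_n$, where $g_0$ has distribution $\theta$ and is independent of the i.i.d. $\mu$-distributed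 increments $h_i$; put $\mathbf P=\mathbf P_{\delta_e}$, and let $\mathbf P_\#$ be the measure with the counting measure on $G$ as initial distribution. The Poisson boundary $\partial_\mu G$ is the space of ergodic components of the time shift on $(G^{\mathbb Z_+},\mathbf P_\#)$, i.e., in the measure category, the quotient of the path space whose measurable sets are the shift invariant measurable sets of paths. It carries the harmonic measure $\nu$, which is the image of $\mathbf P$, and the $G$-action induced by left translations of paths. The walk $(G,\mu)$ is Liouville if $\nu$ is a point measure in the measure category, i.e., each measurable set is $\nu$-null or $\nu$-conull. A $\mu$-boundary is a measurable $G$-space $B$ with a probability measure $\lambda$ that is the image of $\nu$ under a measurable map $\partial_\mu G\to B$ that is $G$-equivariant almost everywhere (with respect to the image of $\mathbf P_\#$). It is non-trivial if $\lambda$ is not a point measure. **Theorem.** Let $\mu$ be a finitely supported probability measure on $\widetilde F$ that is strictly non-degenerate, i.e., its support generates $\widetilde F$ as a semigroup. Then for $\mathbf P$-almost every sample path $(g_n)$ of the random walk $(\widetilde F,\mu)$ the configurations $C_{g_n}$ converge pointwise on $\Gamma$ to a limit configuration $C_\infty\in\mathrm{Fun}(\Gamma,\mathbb Z)$. The assignment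 $(g_n)\mapsto C_\infty$ is measurable and coincides $\mathbf P$-a.e. with the composition of the projection $\widetilde F^{\mathbb Z_+}\to\partial_\mu\widetilde F$ and a measurable map $\partial_\mu\widetilde F\to\mathrm{Fun}(\Gamma,\mathbb Z)$ that is $\widetilde F$-equivariant almost everywhere, and the space $\mathrm{Fun}(\Gamma,\mathbb Z)$ endowed with the distribution $\lambda$ of $C_\infty$ is a non-trivial $\mu$-boundary. Therefore the Poisson boundary $(\partial_\mu\widetilde F,\nu)$ is non-trivial, i.e., the random walk $(\widetilde F,\mu)$ is not Liouville. -/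

import Mathlib

open Filter Topology MeasureTheory

namespace ThompsonWalk

/-! ### Dyadic rationals -/

/-- `x` is a dyadic rational number, `x ∈ ℤ[1/2]`. -/
def IsDyadic (x : ℝ) : Prop := ∃ (k : ℤ) (m : ℕ), x = k / 2 ^ m

theorem IsDyadic.add {x y : ℝ} (hx : IsDyadic x) (hy : IsDyadic y) : IsDyadic (x + y) := by
  obtain ⟨k, m, rfl⟩ := hx
  obtain ⟨l, n, rfl⟩ := hy
  refine ⟨k * 2 ^ n + l * 2 ^ m, m + n, ?_⟩
  push_cast
  rw [div_add_div _ _ (by positivity) (by positivity), pow_add, mul_comm ((2 : ℝ) ^ m) (l : ℝ)]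

theorem IsDyadic.neg {x : ℝ} (hx : IsDyadic x) : IsDyadic (-x) := by
  obtain ⟨k, m, rfl⟩ := hx
  exact ⟨-k, m, by push_cast; ring⟩

theorem IsDyadic.sub {x y : ℝ} (hx : IsDyadic x) (hy : IsDyadic y) : IsDyadic (x - y) := by
  rw [sub_eq_add_neg]
  exact hx.add hy.neg

theorem IsDyadic.zpow_mul {x : ℝ} (hx : IsDyadic x) (n : ℤ) : IsDyadic ((2 : ℝ) ^ n * x) := by
  obtain ⟨k, m, rfl⟩ := hx
  obtain ⟨a, rfl | rfl⟩ := n.eq_nat_or_neg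
  · exact ⟨2 ^ a * k, m, by push_cast; rw [zpow_natCast]; ring⟩
  · refine ⟨k, m + a, ?_⟩
    rw [zpow_neg, zpow_natCast]
    field_simp
    ring

theorem isDyadic_intCast (n : ℤ) : IsDyadic n := ⟨n, 0, by simp⟩

/-- The vertex set `Γ ≅ ℤ[1/2]` of the dyadic Schreier graph. -/
abbrev DyadicPoint : Type := {x : ℝ // IsDyadic x}

instance : Countable DyadicPoint := by
  have h : {x : ℝ | IsDyadic x}.Countable := by
    refine (Set.countable_range (fun p : ℤ × ℕ => (p.1 : ℝ) / 2 ^ p.2)).mono ?_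
    rintro x ⟨k, m, rfl⟩
    exact ⟨(k, m), rfl⟩
  exact h.to_subtype

/-! ### Thompson's group as a group of piecewise linear homeomorphisms of the line -/

/-- On some interval `(x - ε, x]` the function `g` is affine with slope `2 ^ m`. -/
def AffineLeft (g : ℝ → ℝ) (x : ℝ) (m : ℤ) : Prop :=
  ∀ᶠ y in 𝓝[≤] x, g y = g x + (2 : ℝ) ^ m * (y - x)

/-- On some interval `[x, x + ε)` the function `g` is affine with slope `2 ^ n`. -/
def AffineRight (g : ℝ → ℝ) (x : ℝ) (n : ℤ) : Prop :=
  ∀ᶠ y in 𝓝[≥] x, g y = g x + (2 : ℝ) ^ n * (y - x)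

/-- An orientation preserving homeomorphism `g` of the real line (that is, an order
isomorphism) is piecewise linear with finitely many break points, which are all dyadic rational,
its slopes are integer powers of `2`, and near `-∞` and near `+∞` it is a translation by an
integer. -/
structure IsThompson (g : ℝ ≃o ℝ) : Prop where
  piecewise_affine : ∃ B : Finset ℝ, (∀ b ∈ B, IsDyadic b) ∧
    ∀ x, ∃ m n : ℤ, AffineLeft g x m ∧ AffineRight g x n ∧ (x ∉ B → m = n)
  translation_bot : ∃ C : ℤ, ∀ᶠ x in atBot, g x = x + C
  translation_top : ∃ C : ℤ, ∀ᶠ x in atTop, g x = x + C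

theorem eventually_left {p : ℝ → Prop} {x : ℝ} (h : ∀ᶠ y in 𝓝[≤] x, p y) :
    ∀ᶠ y in 𝓝[≤] x, ∀ᶠ z in 𝓝[≤] y, p z := by
  obtain ⟨l, hl, hs⟩ := mem_nhdsLE_iff_exists_Ioc_subset.1 h
  refine mem_nhdsLE_iff_exists_Ioc_subset.2 ⟨l, hl, fun y hy => ?_⟩
  exact mem_nhdsLE_iff_exists_Ioc_subset.2 ⟨l, hy.1, fun z hz => hs ⟨hz.1, hz.2.trans hy.2⟩⟩

theorem eventually_right {p : ℝ → Prop} {x : ℝ} (h : ∀ᶠ y in 𝓝[≥] x, p y) :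
    ∀ᶠ y in 𝓝[>] x, ∀ᶠ z in 𝓝[≤] y, p z := by
  obtain ⟨u, hu, hs⟩ := mem_nhdsGE_iff_exists_Ico_subset.1 h
  refine mem_nhdsGT_iff_exists_Ioo_subset.2 ⟨u, hu, fun y hy => ?_⟩
  exact mem_nhdsLE_iff_exists_Ioc_subset.2
    ⟨x, hy.1, fun z hz => hs ⟨hz.1.le, lt_of_le_of_lt hz.2 hy.2⟩⟩

theorem germ_unique {g h : ℝ → ℝ} {y c d : ℝ} {m n : ℤ} (hg : ∀ᶠ z in 𝓝[≤] y, g z = 2 ^ m * z + c)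
    (hh : ∀ᶠ z in 𝓝[≤] y, h z = 2 ^ n * z + d) (e : ∀ᶠ z in 𝓝[≤] y, g z = h z) :
    m = n ∧ c = d := by
  obtain ⟨l, hl, hs⟩ := mem_nhdsLE_iff_exists_Ioc_subset.1 ((hg.and hh).and e)
  obtain ⟨z, hlz, hzy⟩ := exists_between (show l < y from hl)
  obtain ⟨⟨a1, a2⟩, a3⟩ := hs ⟨hl, le_rfl⟩
  obtain ⟨⟨b1, b2⟩, b3⟩ := hs ⟨hlz, hzy.le⟩
  have e1 : ((2 : ℝ) ^ m - 2 ^ n) * (y - z) = 0 := by linarith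
  have e2 : (2 : ℝ) ^ m = 2 ^ n := by
    rcases mul_eq_zero.1 e1 with h0 | h0
    · linarith
    · linarith
  have e3 : m = n := zpow_right_injective₀ (by norm_num) (by norm_num) e2
  subst e3
  exact ⟨rfl, by linarith⟩

theorem AffineLeft.germ {g : ℝ → ℝ} {x : ℝ} {m : ℤ} (h : AffineLeft g x m) :
    ∀ᶠ y in 𝓝[≤] x, g y = 2 ^ m * y + (g x - 2 ^ m * x) :=
  h.mono fun y hy => by rw [hy]; ring

theorem AffineRight.germ {g : ℝ → ℝ} {x : ℝ} {m : ℤ} (h : AffineRight g x m) :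
    ∀ᶠ y in 𝓝[≥] x, g y = 2 ^ m * y + (g x - 2 ^ m * x) :=
  h.mono fun y hy => by rw [hy]; ring

theorem forall_of_locally {P : ℝ → Prop} (h : ∀ x, ∀ᶠ y in 𝓝 x, (P y ↔ P x)) (a : ℝ) (ha : P a)
    (x : ℝ) : P x := by
  have : IsLocallyConstant P :=
    (IsLocallyConstant.iff_eventually_eq P).2 fun x => (h x).mono fun y hy => propext hy
  rw [this.apply_eq_of_preconnectedSpace x a]
  exact ha

theorem eventually_nhds_of_left_right {P : ℝ → Prop} {x : ℝ} (h1 : ∀ᶠ y in 𝓝[≤] x, P y)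
    (h2 : ∀ᶠ y in 𝓝[>] x, P y) : ∀ᶠ y in 𝓝 x, P y := by
  rw [← nhdsLE_sup_nhdsGT x]
  exact eventually_sup.2 ⟨h1, h2⟩

theorem IsThompson.isDyadic_iff {g : ℝ ≃o ℝ} (hg : IsThompson g) (x : ℝ) :
    IsDyadic (g x) ↔ IsDyadic x := by
  obtain ⟨B, hB, hx⟩ := hg.piecewise_affine
  let P : ℝ → Prop := fun y => ∃ (m : ℤ) (c : ℝ), IsDyadic c ∧ ∀ᶠ z in 𝓝[≤] y, g z = 2 ^ m * z + c
  have key : ∀ {y : ℝ} {m : ℤ} {c : ℝ}, (∀ᶠ z in 𝓝[≤] y, g z = 2 ^ m * z + c) →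
      (P y ↔ IsDyadic c) := by
    intro y m c h
    refine ⟨?_, fun hc => ⟨m, c, hc, h⟩⟩
    rintro ⟨n, d, hd, h'⟩
    have := (germ_unique h h' (Eventually.of_forall fun z => rfl)).2
    rwa [this]
  have loc : ∀ x, ∀ᶠ y in 𝓝 x, (P y ↔ P x) := by
    intro x
    obtain ⟨m, n, hl, hr, hmn⟩ := hx x
    have hPx := key hl.germ
    refine eventually_nhds_of_left_right ?_ ?_
    · filter_upwards [eventually_left hl.germ] with y hy
      rw [key hy, hPx]
    · filter_upwards [eventually_right hr.germ] with y hy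
      rw [key hy, hPx]
      by_cases hxB : x ∈ B
      · have dx := hB x hxB
        constructor
        · intro h
          have := (h.add (dx.zpow_mul n)).sub (dx.zpow_mul m)
          convert this using 1
          ring
        · intro h
          have := (h.add (dx.zpow_mul m)).sub (dx.zpow_mul n)
          convert this using 1
          ring
      · rw [hmn hxB]
  obtain ⟨C, hC⟩ := hg.translation_bot
  obtain ⟨M, hM⟩ := eventually_atBot.1 hC
  have hP : P x := by
    refine forall_of_locally loc M ⟨0, C, isDyadic_intCast C, ?_⟩ x
    filter_upwards [self_mem_nhdsWithin] with z hz
    rw [hM z hz]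
    simp
  obtain ⟨m, c, hc, h⟩ := hP
  have e : g x = 2 ^ m * x + c := h.self_of_nhdsWithin (Set.self_mem_Iic)
  constructor
  · intro h
    have := (h.sub hc).zpow_mul (-m)
    rw [e, add_sub_cancel_right, ← mul_assoc, ← zpow_add₀ (by norm_num)] at this
    simpa using this
  · intro h
    rw [e]
    exact (h.zpow_mul m).add hc

theorem AffineLeft.comp {f g : ℝ ≃o ℝ} {x : ℝ} {m n : ℤ} (hf : AffineLeft f x m)
    (hg : AffineLeft g (f x) n) : AffineLeft (f.trans g) x (m + n) := by
  have ht : Tendsto f (𝓝[≤] x) (𝓝[≤] (f x)) :=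
    f.continuous.continuousWithinAt.tendsto_nhdsWithin fun y hy => f.monotone hy
  filter_upwards [hf, ht.eventually hg] with y h1 h2
  simp only [OrderIso.trans_apply]
  rw [h2, h1, zpow_add₀ (by norm_num)]
  ring

theorem AffineRight.comp {f g : ℝ ≃o ℝ} {x : ℝ} {m n : ℤ} (hf : AffineRight f x m)
    (hg : AffineRight g (f x) n) : AffineRight (f.trans g) x (m + n) := by
  have ht : Tendsto f (𝓝[≥] x) (𝓝[≥] (f x)) :=
    f.continuous.continuousWithinAt.tendsto_nhdsWithin fun y hy => f.monotone hy
  filter_upwards [hf, ht.eventually hg] with y h1 h2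
  simp only [OrderIso.trans_apply]
  rw [h2, h1, zpow_add₀ (by norm_num)]
  ring

theorem AffineLeft.inv {f : ℝ ≃o ℝ} {x : ℝ} {m : ℤ} (hf : AffineLeft f (f.symm x) m) :
    AffineLeft f.symm x (-m) := by
  have ht : Tendsto f.symm (𝓝[≤] x) (𝓝[≤] (f.symm x)) :=
    f.symm.continuous.continuousWithinAt.tendsto_nhdsWithin fun y hy => f.symm.monotone hy
  filter_upwards [ht.eventually hf] with y h1
  simp only [OrderIso.apply_symm_apply] at h1
  have e : y - x = (2 : ℝ) ^ m * (f.symm y - f.symm x) := by linarith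
  rw [e, ← mul_assoc, ← zpow_add₀ (by norm_num), neg_add_cancel, zpow_zero]
  ring

theorem AffineRight.inv {f : ℝ ≃o ℝ} {x : ℝ} {m : ℤ} (hf : AffineRight f (f.symm x) m) :
    AffineRight f.symm x (-m) := by
  have ht : Tendsto f.symm (𝓝[≥] x) (𝓝[≥] (f.symm x)) :=
    f.symm.continuous.continuousWithinAt.tendsto_nhdsWithin fun y hy => f.symm.monotone hy
  filter_upwards [ht.eventually hf] with y h1
  simp only [OrderIso.apply_symm_apply] at h1
  have e : y - x = (2 : ℝ) ^ m * (f.symm y - f.symm x) := by linarith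
  rw [e, ← mul_assoc, ← zpow_add₀ (by norm_num), neg_add_cancel, zpow_zero]
  ring

theorem isThompson_refl : IsThompson (OrderIso.refl ℝ) where
  piecewise_affine := ⟨∅, by simp, fun x => ⟨0, 0, by
    exact Eventually.of_forall fun y => by simp, by
    exact Eventually.of_forall fun y => by simp, fun _ => rfl⟩⟩
  translation_bot := ⟨0, Eventually.of_forall fun y => by simp⟩
  translation_top := ⟨0, Eventually.of_forall fun y => by simp⟩

theorem IsThompson.trans {f g : ℝ ≃o ℝ} (hf : IsThompson f) (hg : IsThompson g) :
    IsThompson (f.trans g) where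
  piecewise_affine := by
    classical
    obtain ⟨B, hB, hfx⟩ := hf.piecewise_affine
    obtain ⟨B', hB', hgx⟩ := hg.piecewise_affine
    refine ⟨B ∪ B'.image f.symm, fun b hb => ?_, fun x => ?_⟩
    · rcases Finset.mem_union.1 hb with h | h
      · exact hB b h
      · obtain ⟨c, hc, rfl⟩ := Finset.mem_image.1 h
        rw [← hf.isDyadic_iff]
        simpa using hB' c hc
    · obtain ⟨m, n, hl, hr, h⟩ := hfx x
      obtain ⟨m', n', hl', hr', h'⟩ := hgx (f x)
      refine ⟨m + m', n + n', hl.comp hl', hr.comp hr', fun hx => ?_⟩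
      simp only [Finset.mem_union, Finset.mem_image, not_or, not_exists, not_and] at hx
      rw [h hx.1, h' fun hb => hx.2 _ hb (by simp)]
  translation_bot := by
    obtain ⟨C, hC⟩ := hf.translation_bot
    obtain ⟨D, hD⟩ := hg.translation_bot
    refine ⟨C + D, ?_⟩
    filter_upwards [hC, f.tendsto_atBot.eventually hD] with x h1 h2
    simp only [OrderIso.trans_apply]
    rw [h2, h1]
    push_cast
    ring
  translation_top := by
    obtain ⟨C, hC⟩ := hf.translation_top
    obtain ⟨D, hD⟩ := hg.translation_top
    refine ⟨C + D, ?_⟩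
    filter_upwards [hC, f.tendsto_atTop.eventually hD] with x h1 h2
    simp only [OrderIso.trans_apply]
    rw [h2, h1]
    push_cast
    ring

theorem IsThompson.symm {f : ℝ ≃o ℝ} (hf : IsThompson f) : IsThompson f.symm where
  piecewise_affine := by
    classical
    obtain ⟨B, hB, hfx⟩ := hf.piecewise_affine
    refine ⟨B.image f, fun b hb => ?_, fun x => ?_⟩
    · obtain ⟨c, hc, rfl⟩ := Finset.mem_image.1 hb
      rw [hf.isDyadic_iff]
      exact hB c hc
    · obtain ⟨m, n, hl, hr, h⟩ := hfx (f.symm x)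
      refine ⟨-m, -n, hl.inv, hr.inv, fun hx => ?_⟩
      rw [h fun hb => hx (Finset.mem_image.2 ⟨_, hb, by simp⟩)]
  translation_bot := by
    obtain ⟨C, hC⟩ := hf.translation_bot
    refine ⟨-C, ?_⟩
    filter_upwards [f.symm.tendsto_atBot.eventually hC] with x h1
    simp only [OrderIso.apply_symm_apply] at h1
    push_cast
    linarith
  translation_top := by
    obtain ⟨C, hC⟩ := hf.translation_top
    refine ⟨-C, ?_⟩
    filter_upwards [f.symm.tendsto_atTop.eventually hC] with x h1
    simp only [OrderIso.apply_symm_apply] at h1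
    push_cast
    linarith

/-- Thompson's group `F`, realized as the group of all homeomorphisms of the real line as in
`IsThompson`. -/
@[ext]
structure ThompsonF where
  toOrderIso : ℝ ≃o ℝ
  isThompson : IsThompson toOrderIso

/-- The group operation is the composition in postfix order: `(g₁ * g₂) x = g₂ (g₁ x)`. -/
instance : Group ThompsonF where
  mul g₁ g₂ := ⟨g₁.toOrderIso.trans g₂.toOrderIso, g₁.isThompson.trans g₂.isThompson⟩
  one := ⟨OrderIso.refl ℝ, isThompson_refl⟩
  inv g := ⟨g.toOrderIso.symm, g.isThompson.symm⟩
  mul_assoc _ _ _ := rfl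
  one_mul _ := rfl
  mul_one _ := rfl
  inv_mul_cancel g := ThompsonF.ext (OrderIso.symm_trans_self g.toOrderIso)

/-- The right action `γ.g = g(γ)` of the group on the dyadic rationals. -/
def act (γ : DyadicPoint) (g : ThompsonF) : DyadicPoint :=
  ⟨g.toOrderIso γ.1, (g.isThompson.isDyadic_iff γ.1).2 γ.2⟩

theorem act_one (γ : DyadicPoint) : act γ 1 = γ := rfl

theorem act_mul (γ : DyadicPoint) (g h : ThompsonF) : act γ (g * h) = act (act γ g) h := rfl

/-! ### Configurations -/

/-- The space `Fun(Γ, ℤ)` of all integer valued configurations on the dyadic rationals. -/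
def Config : Type := DyadicPoint → ℤ

/-- The product σ-algebra. -/
instance : MeasurableSpace Config := inferInstanceAs (MeasurableSpace (DyadicPoint → ℤ))

/-- The configuration `C_g(γ) = log₂ g'(γ + 0) - log₂ g'(γ - 0)`. The one-sided slopes are integer
powers of `2`, on which `Int.log 2` is the logarithm to base `2`, see `jumpConfig_eq_logb`. -/
noncomputable def jumpConfig (g : ThompsonF) : Config := fun γ =>
  Int.log 2 (derivWithin g.toOrderIso (Set.Ici γ.1) γ.1) -
    Int.log 2 (derivWithin g.toOrderIso (Set.Iic γ.1) γ.1)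

theorem AffineLeft.derivWithin {g : ℝ → ℝ} {x : ℝ} {m : ℤ} (h : AffineLeft g x m) :
    derivWithin g (Set.Iic x) x = 2 ^ m := by
  have h1 : HasDerivWithinAt (fun y => g x + (2 : ℝ) ^ m * (y - x)) (2 ^ m) (Set.Iic x) x := by
    simpa using ((((hasDerivAt_id x).sub_const x).const_mul ((2 : ℝ) ^ m)).const_add
      (g x)).hasDerivWithinAt (s := Set.Iic x)
  exact (h1.congr_of_eventuallyEq h (by simp)).derivWithin (uniqueDiffWithinAt_Iic x)

theorem AffineRight.derivWithin {g : ℝ → ℝ} {x : ℝ} {m : ℤ} (h : AffineRight g x m) :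
    derivWithin g (Set.Ici x) x = 2 ^ m := by
  have h1 : HasDerivWithinAt (fun y => g x + (2 : ℝ) ^ m * (y - x)) (2 ^ m) (Set.Ici x) x := by
    simpa using ((((hasDerivAt_id x).sub_const x).const_mul ((2 : ℝ) ^ m)).const_add
      (g x)).hasDerivWithinAt (s := Set.Ici x)
  exact (h1.congr_of_eventuallyEq h (by simp)).derivWithin (uniqueDiffWithinAt_Ici x)

theorem jumpConfig_eq {g : ThompsonF} {γ : DyadicPoint} {m n : ℤ}
    (hl : AffineLeft g.toOrderIso γ.1 m) (hr : AffineRight g.toOrderIso γ.1 n) :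
    jumpConfig g γ = n - m := by
  have h : ∀ k : ℤ, Int.log 2 ((2 : ℝ) ^ k) = k := fun k => by
    have := Int.log_zpow (R := ℝ) (b := 2) one_lt_two k
    simpa using this
  rw [jumpConfig, hl.derivWithin, hr.derivWithin, h, h]

theorem exists_slopes (g : ThompsonF) (x : ℝ) :
    ∃ m n : ℤ, AffineLeft g.toOrderIso x m ∧ AffineRight g.toOrderIso x n := by
  obtain ⟨B, -, h⟩ := g.isThompson.piecewise_affine
  obtain ⟨m, n, hl, hr, -⟩ := h x
  exact ⟨m, n, hl, hr⟩

theorem jumpConfig_eq_logb (g : ThompsonF) (γ : DyadicPoint) :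
    (jumpConfig g γ : ℝ) = Real.logb 2 (derivWithin g.toOrderIso (Set.Ici γ.1) γ.1) -
      Real.logb 2 (derivWithin g.toOrderIso (Set.Iic γ.1) γ.1) := by
  obtain ⟨m, n, hl, hr⟩ := exists_slopes g γ.1
  have h : ∀ k : ℤ, Real.logb 2 ((2 : ℝ) ^ k) = k := fun k => by
    rw [← Real.rpow_intCast, Real.logb_rpow (by norm_num) (by norm_num)]
  rw [jumpConfig_eq hl hr, hl.derivWithin, hr.derivWithin, h, h]
  push_cast
  ring

theorem jumpConfig_one (γ : DyadicPoint) : jumpConfig 1 γ = 0 := by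
  have hl : AffineLeft (1 : ThompsonF).toOrderIso γ.1 0 :=
    Eventually.of_forall fun y => by
      change y = γ.1 + _
      simp
  have hr : AffineRight (1 : ThompsonF).toOrderIso γ.1 0 :=
    Eventually.of_forall fun y => by
      change y = γ.1 + _
      simp
  rw [jumpConfig_eq hl hr, sub_self]

theorem jumpConfig_mul (g h : ThompsonF) (γ : DyadicPoint) :
    jumpConfig (g * h) γ = jumpConfig g γ + jumpConfig h (act γ g) := by
  obtain ⟨m, n, hl, hr⟩ := exists_slopes g γ.1
  obtain ⟨m', n', hl', hr'⟩ := exists_slopes h (act γ g).1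
  rw [jumpConfig_eq hl hr, jumpConfig_eq hl' hr']
  have e1 : AffineLeft (g * h).toOrderIso γ.1 (m + m') := AffineLeft.comp hl hl'
  have e2 : AffineRight (g * h).toOrderIso γ.1 (n + n') := AffineRight.comp hr hr'
  rw [jumpConfig_eq e1 e2]
  ring

/-- The skew action `g • C = C_g + S^g C` on configurations, where `S^g C (γ) = C (γ.g)`. -/
noncomputable instance : MulAction ThompsonF Config where
  smul g c := fun γ => jumpConfig g γ + c (act γ g)
  one_smul c := funext fun γ => by
    change jumpConfig 1 γ + c (act γ 1) = c γ
    rw [jumpConfig_one, act_one, zero_add]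
  mul_smul g h c := funext fun γ => by
    change jumpConfig (g * h) γ + c (act γ (g * h)) =
      jumpConfig g γ + (jumpConfig h (act γ g) + c (act (act γ g) h))
    rw [jumpConfig_mul, act_mul, add_assoc]

theorem smul_config_apply (g : ThompsonF) (c : Config) (γ : DyadicPoint) :
    (g • c) γ = jumpConfig g γ + c (act γ g) := rfl

instance : MeasurableConstSMul ThompsonF Config where
  measurable_const_smul g := by
    refine measurable_pi_iff.2 fun γ => ?_
    exact (measurable_pi_apply (X := fun _ : DyadicPoint => ℤ) (act γ g)).const_add
      (jumpConfig g γ)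

theorem finite_support_jumpConfig (g : ThompsonF) : (Function.support (jumpConfig g)).Finite := by
  obtain ⟨B, -, h⟩ := g.isThompson.piecewise_affine
  refine (B.finite_toSet.preimage Subtype.val_injective.injOn).subset fun γ hγ => ?_
  by_contra hB
  obtain ⟨m, n, hl, hr, hmn⟩ := h γ.1
  refine hγ ?_
  rw [jumpConfig_eq hl hr, hmn hB, sub_self]

theorem eq_of_jumpConfig_eq {g h : ThompsonF} (hC : jumpConfig g = jumpConfig h)
    (hbot : ∀ᶠ x in atBot, g.toOrderIso x = h.toOrderIso x) : g = h := by
  obtain ⟨B, hB, hg⟩ := g.isThompson.piecewise_affine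
  obtain ⟨B', hB', hh⟩ := h.isThompson.piecewise_affine
  let P : ℝ → Prop := fun y => ∀ᶠ z in 𝓝[≤] y, g.toOrderIso z = h.toOrderIso z
  have key : ∀ {y : ℝ} {m m' : ℤ} {c c' : ℝ},
      (∀ᶠ z in 𝓝[≤] y, g.toOrderIso z = 2 ^ m * z + c) →
      (∀ᶠ z in 𝓝[≤] y, h.toOrderIso z = 2 ^ m' * z + c') → (P y ↔ m = m' ∧ c = c') := by
    intro y m m' c c' h1 h2
    refine ⟨fun hP => germ_unique h1 h2 hP, ?_⟩
    rintro ⟨rfl, rfl⟩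
    filter_upwards [h1, h2] with z e1 e2
    rw [e1, e2]
  have loc : ∀ x, ∀ᶠ y in 𝓝 x, (P y ↔ P x) := by
    intro x
    obtain ⟨m, n, hl, hr, hmn⟩ := hg x
    obtain ⟨m', n', hl', hr', hmn'⟩ := hh x
    have hjump : n - m = n' - m' := by
      by_cases hx : IsDyadic x
      · have := congrFun hC ⟨x, hx⟩
        rwa [jumpConfig_eq (γ := ⟨x, hx⟩) hl hr, jumpConfig_eq (γ := ⟨x, hx⟩) hl' hr'] at this
      · rw [hmn fun hb => hx (hB x hb), hmn' fun hb => hx (hB' x hb), sub_self, sub_self]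
    have hPx := key hl.germ hl'.germ
    refine eventually_nhds_of_left_right ?_ ?_
    · filter_upwards [eventually_left hl.germ, eventually_left hl'.germ] with y hy hy'
      rw [key hy hy', hPx]
    · filter_upwards [eventually_right hr.germ, eventually_right hr'.germ] with y hy hy'
      rw [key hy hy', hPx]
      constructor
      · rintro ⟨e1, e2⟩
        obtain rfl : m = m' := by omega
        subst e1
        exact ⟨rfl, by linarith⟩
      · rintro ⟨e1, e2⟩
        obtain rfl : n = n' := by omega
        subst e1
        exact ⟨rfl, by linarith⟩
  obtain ⟨M, hM⟩ := eventually_atBot.1 hbot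
  refine ThompsonF.ext (OrderIso.ext (funext fun x => ?_))
  have hP : P x := forall_of_locally loc M
    (by filter_upwards [self_mem_nhdsWithin] with z hz using hM z hz) x
  exact hP.self_of_nhdsWithin Set.self_mem_Iic

instance : Countable ThompsonF := by
  choose C hC using fun g : ThompsonF => g.isThompson.translation_bot
  have hinj : Function.Injective fun g : ThompsonF =>
      ((Finsupp.ofSupportFinite (jumpConfig g) (finite_support_jumpConfig g), C g) :
        (DyadicPoint →₀ ℤ) × ℤ) := by
    intro g h e
    obtain ⟨e1, e2⟩ := Prod.ext_iff.1 e
    refine eq_of_jumpConfig_eq (congrArg (fun f : DyadicPoint →₀ ℤ => (f : DyadicPoint → ℤ)) e1) ?_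
    filter_upwards [hC g, hC h] with x h1 h2
    rw [h1, h2]
    exact congrArg (fun k : ℤ => x + (k : ℝ)) e2
  exact hinj.countable

instance : MeasurableSpace ThompsonF := ⊤

instance : DiscreteMeasurableSpace ThompsonF := ⟨fun _ => trivial⟩

/-! ### Random walks on countable groups -/

section RandomWalk

variable {G : Type*} [Group G]

/-- The path `g, g h₁, g h₁ h₂, …` with starting point `g` and increments `hₙ₊₁ = h n`. -/
def walk (g : G) (h : ℕ → G) : ℕ → G
  | 0 => g
  | n + 1 => walk g h n * h n

theorem measurable_walk [Countable G] [MeasurableSpace G] [DiscreteMeasurableSpace G] :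
    Measurable fun p : G × (ℕ → G) => walk p.1 p.2 := by
  refine measurable_pi_iff.2 fun n => ?_
  induction n with
  | zero => exact measurable_fst
  | succ n ih =>
    exact (Measurable.of_discrete (f := fun q : G × G => q.1 * q.2)).comp
      (ih.prodMk ((measurable_pi_apply n).comp measurable_snd))

/-- The Markov measure `P_θ` on the path space `ℕ → G` of the (right) random walk with step
distribution `μ` and initial distribution `θ`: independent `μ`-distributed increments. -/
noncomputable def pathMeasure [MeasurableSpace G] (μ : PMF G) (θ : Measure G) :
    Measure (ℕ → G) :=
  (θ.prod (Measure.infinitePi fun _ : ℕ => μ.toMeasure)).map fun p => walk p.1 p.2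

/-- `μ` is strictly non-degenerate: its support generates `G` as a semigroup. -/
def StrictlyNondegenerate (μ : PMF G) : Prop := Subsemigroup.closure μ.support = ⊤

end RandomWalk

/-! ### The Poisson boundary -/

section Poisson

/-- The time shift on the path space. -/
def shift {G : Type*} (x : ℕ → G) : ℕ → G := fun n => x (n + 1)

/-- Two paths are equivalent if they lie in the same (grand) orbit of the time shift:
for some `m` and `n` one has `x (k + m) = y (k + n)` for all `k`. -/
def shiftSetoid (G : Type*) : Setoid (ℕ → G) where
  r x y := ∃ m n : ℕ, shift^[m] x = shift^[n] y
  iseqv :=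
    { refl := fun _ => ⟨0, 0, rfl⟩
      symm := fun ⟨m, n, h⟩ => ⟨n, m, h.symm⟩
      trans := by
        rintro x y z ⟨m, n, h⟩ ⟨k, l, h'⟩
        refine ⟨k + m, n + l, ?_⟩
        rw [Function.iterate_add_apply, h, ← Function.iterate_add_apply, add_comm k n,
          Function.iterate_add_apply, h', ← Function.iterate_add_apply] }

/-- The space of ergodic components of the time shift, as a measurable space: the quotient of the
path space by the orbit equivalence relation of the shift with the quotient σ-algebra, so that its
measurable subsets are precisely the shift invariant measurable sets of paths. Endowed with the
class of the measure `boundaryMeasure μ Measure.count` (which depends on the step distribution `μ`)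
it is the Poisson boundary of the random walk `(G, μ)`, considered as usual in the measure
category: only measurable sets modulo null sets matter. -/
def PoissonBoundary (G : Type*) : Type _ := Quotient (shiftSetoid G)

instance (G : Type*) [MeasurableSpace G] : MeasurableSpace (PoissonBoundary G) :=
  inferInstanceAs (MeasurableSpace (Quotient (shiftSetoid G)))

/-- The quotient map from the path space to the Poisson boundary. -/
def bnd {G : Type*} (x : ℕ → G) : PoissonBoundary G := Quotient.mk (shiftSetoid G) x

theorem measurableSet_boundary_iff {G : Type*} [MeasurableSpace G] {A : Set (PoissonBoundary G)} :
    MeasurableSet A ↔ MeasurableSet (bnd ⁻¹' A) := Iff.rfl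

theorem measurable_bnd {G : Type*} [MeasurableSpace G] :
    Measurable (bnd : (ℕ → G) → PoissonBoundary G) := fun _ h => h

variable {G : Type*} [Group G]

theorem shift_iterate_mul (g : G) (x : ℕ → G) (m : ℕ) :
    shift^[m] (fun n => g * x n) = fun n => g * shift^[m] x n := by
  induction m generalizing x with
  | zero => rfl
  | succ m ih => exact ih (shift x)

/-- The action on the Poisson boundary induced by coordinate-wise left translations of paths. -/
instance : MulAction G (PoissonBoundary G) where
  smul g := Quotient.map (fun x n => g * x n) (by
    rintro x y ⟨m, n, h⟩
    exact ⟨m, n, by rw [shift_iterate_mul, shift_iterate_mul, h]⟩)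
  one_smul := by
    rintro ⟨x⟩
    exact congrArg bnd (funext fun n => one_mul (x n))
  mul_smul g h := by
    rintro ⟨x⟩
    exact congrArg bnd (funext fun n => mul_assoc g h (x n))

theorem smul_bnd (g : G) (x : ℕ → G) : g • bnd x = bnd fun n => g * x n := rfl

variable [MeasurableSpace G]

/-- The image `ν_θ` on the Poisson boundary of the measure `P_θ` on the path space. -/
noncomputable def boundaryMeasure (μ : PMF G) (θ : Measure G) : Measure (PoissonBoundary G) :=
  (pathMeasure μ θ).map bnd

/-- The harmonic measure `ν`, i.e. `ν_θ` for the walk issued from the identity. -/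
noncomputable def harmonicMeasure (μ : PMF G) : Measure (PoissonBoundary G) :=
  boundaryMeasure μ (Measure.dirac 1)

/-- A measure is trivial, i.e. a point measure in the measure category, if each measurable set
is either null or conull. -/
def IsTrivialMeasure {B : Type*} [MeasurableSpace B] (m : Measure B) : Prop :=
  ∀ A : Set B, MeasurableSet A → m A = 0 ∨ m Aᶜ = 0

/-- The random walk `(G, μ)` is Liouville if its harmonic measure is a point measure, i.e. if its
Poisson boundary is trivial. -/
def LiouvilleWalk (μ : PMF G) : Prop := IsTrivialMeasure (harmonicMeasure μ)

/-- A measurable map from the Poisson boundary to a measurable `G`-space is `G`-equivariant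
modulo null sets of the Poisson boundary (with respect to the measure class determined by the
counting initial distribution). -/
structure IsBoundaryMap (μ : PMF G) {B : Type*} [MeasurableSpace B] [MulAction G B]
    (π : PoissonBoundary G → B) : Prop where
  measurable : Measurable π
  equivariant : ∀ g : G, ∀ᵐ ξ ∂(boundaryMeasure μ Measure.count), π (g • ξ) = g • π ξ

/-- The measurable `G`-space `B` with the measure `ρ` is a `μ`-boundary: an equivariant quotient
of the Poisson boundary endowed with the harmonic measure. -/
def IsMuBoundary (μ : PMF G) {B : Type*} [MeasurableSpace B] [MulAction G B]
    [MeasurableConstSMul G B] (ρ : Measure B) : Prop :=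
  ∃ π : PoissonBoundary G → B, IsBoundaryMap μ π ∧ (harmonicMeasure μ).map π = ρ

end Poisson

end ThompsonWalk

open ThompsonWalk

namespace ThompsonWalk

/-! ### Two elements of Thompson's group -/

/-! The cocycle identity `jumpConfig_mul` shows that the step from `g_n` to `g_n h` changes the
configuration at `γ` by `C_h(γ.g_n)`. The increments take finitely many values, so their
configurations live on one finite set `K` of dyadic points. If `γ.g_n` visits `K` only finitely
often, the value at `γ` is eventually constant. Thus convergence reduces to transience of the
induced chain on the dyadic rationals.

Transience comes from a binary tree: `x ↦ x/2` and `x ↦ (x+1)/2` agree on `[0, 1]` with elements of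
the group and carry each level of the tree injectively onto one half of the next. Averaging a square
summable `u` over the levels bounds `|u(1/2)|` by the displacements of `u` under these two elements
(`abs_apply_root_le`). As the support of `μ` generates the group as a semigroup and the action is
transitive, every value of `u` is bounded by the square root of its Dirichlet form
(`exists_abs_apply_le`). Applied to the partial sums of the Green function this gives its finiteness
(`summable_iterate_markov_delta`), and Borel–Cantelli gives transience. No symmetry of `μ` is
needed.

The limit is shift invariant and equivariant, hence a boundary map. Were its law trivial, it would
be a point mass at some `c`. Splitting off the first increment shows that `c` is fixed by the
support of `μ`, hence by the whole group. But an element fixing the point `0` with a nonzero jump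
there moves every configuration. -/

theorem affineLeft_of_eqOn {g : ℝ → ℝ} {l x : ℝ} (m : ℤ) (c : ℝ) (hl : l < x)
    (h : ∀ y, l < y → y ≤ x → g y = 2 ^ m * y + c) : AffineLeft g x m := by
  filter_upwards [Ioc_mem_nhdsLE hl] with y hy
  rw [h y hy.1 hy.2, h x hl le_rfl]
  ring

theorem affineRight_of_eqOn {g : ℝ → ℝ} {x u : ℝ} (m : ℤ) (c : ℝ) (hu : x < u)
    (h : ∀ y, x ≤ y → y < u → g y = 2 ^ m * y + c) : AffineRight g x m := by
  filter_upwards [Ico_mem_nhdsGE hu] with y hy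
  rw [h y hy.1 hy.2, h x le_rfl hu]
  ring

/-- The function which is `x` for `x ≤ 0`, `2 * x` on `[0, 1]` and `x + 1` for `x ≥ 1`. -/
noncomputable def stretchFun (x : ℝ) : ℝ := max x (min (2 * x) (x + 1))

theorem stretchFun_of_nonpos {x : ℝ} (h : x ≤ 0) : stretchFun x = x := by
  rw [stretchFun, min_eq_left (by linarith), max_eq_left (by linarith)]

theorem stretchFun_of_mem {x : ℝ} (h : 0 ≤ x) (h' : x ≤ 1) : stretchFun x = 2 * x := by
  rw [stretchFun, min_eq_left (by linarith), max_eq_right (by linarith)]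

theorem stretchFun_of_one_le {x : ℝ} (h : 1 ≤ x) : stretchFun x = x + 1 := by
  rw [stretchFun, min_eq_right (by linarith), max_eq_right (by linarith)]

theorem strictMono_stretchFun : StrictMono stretchFun := fun x y h =>
  max_lt_max h (min_lt_min (by linarith) (by linarith))

theorem surjective_stretchFun : Function.Surjective stretchFun := by
  intro y
  rcases le_total y 0 with h | h
  · exact ⟨y, stretchFun_of_nonpos h⟩
  rcases le_total y 2 with h' | h'
  · exact ⟨y / 2, by rw [stretchFun_of_mem (by linarith) (by linarith)]; ring⟩
  · exact ⟨y - 1, by rw [stretchFun_of_one_le (by linarith)]; ring⟩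

theorem affineLeft_stretchFun_zero : AffineLeft stretchFun 0 0 :=
  affineLeft_of_eqOn (l := -1) 0 0 (by norm_num) fun y _ h => by
    simpa using stretchFun_of_nonpos h

/-- The change of slope at the fixed point `0` is what later rules out an invariant configuration.
-/
theorem affineRight_stretchFun_zero : AffineRight stretchFun 0 1 :=
  affineRight_of_eqOn (u := 1) 1 0 (by norm_num) fun y h h' => by
    simpa using stretchFun_of_mem h h'.le

theorem isThompson_stretch :
    IsThompson (strictMono_stretchFun.orderIsoOfSurjective _ surjective_stretchFun) where
  piecewise_affine := by
    refine ⟨{0, 1}, ?_, fun x => ?_⟩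
    · intro b hb
      rcases Finset.mem_insert.1 hb with rfl | hb
      · exact_mod_cast isDyadic_intCast 0
      · rw [Finset.mem_singleton.1 hb]
        exact_mod_cast isDyadic_intCast 1
    change ∃ m n : ℤ, AffineLeft stretchFun x m ∧ AffineRight stretchFun x n ∧ _
    rcases lt_trichotomy x 0 with h | rfl | h
    · exact ⟨0, 0, affineLeft_of_eqOn (l := x - 1) 0 0 (by linarith) fun y _ hy => by
          simpa using stretchFun_of_nonpos (by linarith),
        affineRight_of_eqOn (u := 0) 0 0 h fun y _ hy => by
          simpa using stretchFun_of_nonpos hy.le, fun _ => rfl⟩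
    · exact ⟨0, 1, affineLeft_stretchFun_zero, affineRight_stretchFun_zero, by simp⟩
    have hl : x ≤ 1 → AffineLeft stretchFun x 1 := fun h' =>
      affineLeft_of_eqOn (l := 0) 1 0 h fun y hy hy' => by
        simpa using stretchFun_of_mem hy.le (hy'.trans h')
    have hr : 1 ≤ x → AffineRight stretchFun x 0 := fun h' =>
      affineRight_of_eqOn (u := x + 1) 0 1 (by linarith) fun y hy _ => by
        simpa using stretchFun_of_one_le (h'.trans hy)
    rcases lt_trichotomy x 1 with h' | rfl | h'
    · exact ⟨1, 1, hl h'.le, affineRight_of_eqOn (u := 1) 1 0 h' fun y hy hy' => by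
          simpa using stretchFun_of_mem (h.le.trans hy) hy'.le, fun _ => rfl⟩
    · exact ⟨1, 0, hl le_rfl, hr le_rfl, by simp⟩
    · exact ⟨0, 0, affineLeft_of_eqOn (l := 1) 0 1 h' fun y hy _ => by
        simpa using stretchFun_of_one_le hy.le, hr h'.le, fun _ => rfl⟩
  translation_bot := ⟨0, by
    filter_upwards [eventually_le_atBot 0] with x hx
    simpa using stretchFun_of_nonpos hx⟩
  translation_top := ⟨1, by
    filter_upwards [eventually_ge_atTop 1] with x hx
    simpa using stretchFun_of_one_le hx⟩

/-- The element of Thompson's group given by `stretchFun`. -/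
noncomputable def stretch : ThompsonF := ⟨_, isThompson_stretch⟩

theorem act_stretch_val (γ : DyadicPoint) : (act γ stretch).1 = stretchFun γ.1 := rfl

theorem isThompson_translate (k : ℤ) : IsThompson (OrderIso.addRight (k : ℝ)) where
  piecewise_affine := ⟨∅, by simp, fun x => ⟨0, 0,
    Eventually.of_forall fun y => by simp; ring,
    Eventually.of_forall fun y => by simp; ring, fun _ => rfl⟩⟩
  translation_bot := ⟨k, Eventually.of_forall fun y => by simp⟩
  translation_top := ⟨k, Eventually.of_forall fun y => by simp⟩

/-- The translation by an integer. -/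
noncomputable def translate (k : ℤ) : ThompsonF := ⟨_, isThompson_translate k⟩

theorem act_translate_val (γ : DyadicPoint) (k : ℤ) : (act γ (translate k)).1 = γ.1 + k := rfl

/-! ### Transitivity of the action on the dyadic rationals. -/

theorem act_act_inv (γ : DyadicPoint) (g : ThompsonF) : act (act γ g) g⁻¹ = γ := by
  rw [← act_mul, mul_inv_cancel, act_one]

theorem act_inv_act (γ : DyadicPoint) (g : ThompsonF) : act (act γ g⁻¹) g = γ := by
  rw [← act_mul, inv_mul_cancel, act_one]

theorem act_eq_iff {γ δ : DyadicPoint} {g : ThompsonF} : act γ g = δ ↔ γ = act δ g⁻¹ :=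
  ⟨fun h => by rw [← h, act_act_inv], fun h => by rw [h, act_inv_act]⟩

theorem act_stretch_inv_val {γ : DyadicPoint} (h : 0 ≤ γ.1) (h' : γ.1 ≤ 2) :
    (act γ stretch⁻¹).1 = γ.1 / 2 := by
  apply strictMono_stretchFun.injective
  rw [← act_stretch_val, act_inv_act, stretchFun_of_mem (by linarith) (by linarith)]
  ring

/-- The element which maps `x` to `(x + 1) / 2` for `x ∈ [-1, 1]`. -/
noncomputable def upperHalf : ThompsonF := translate 1 * stretch⁻¹

theorem act_upperHalf_val {γ : DyadicPoint} (h : 0 ≤ γ.1) (h' : γ.1 ≤ 1) :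
    (act γ upperHalf).1 = (γ.1 + 1) / 2 := by
  have e : (act γ (translate 1)).1 = γ.1 + 1 := by simp [act_translate_val]
  rw [upperHalf, act_mul, act_stretch_inv_val (by linarith) (by linarith), e]

/-- Induction on the exponent of the denominator. After an integer translation the point `y` lies in
`[0, 1)`. One of `2y` and `2y - 1` lies in `[0, 1]`; its denominator exponent is smaller by one, and
`stretch⁻¹` or `upperHalf` maps it back to `y`. -/
theorem exists_act_eq_of_pow (m : ℕ) : ∀ (k : ℤ) (x : DyadicPoint), x.1 = k / 2 ^ m →
    ∃ g, act ⟨0, by simpa using isDyadic_intCast 0⟩ g = x := by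
  induction m with
  | zero =>
    intro k x hx
    exact ⟨translate k, Subtype.ext (by simpa [act_translate_val] using hx.symm)⟩
  | succ m ih =>
    intro k x hx
    set y : DyadicPoint := act x (translate (-⌊x.1⌋)) with hy
    have hy' : y.1 = Int.fract x.1 := by
      rw [hy, act_translate_val, Int.cast_neg, ← sub_eq_add_neg, Int.self_sub_floor]
    have hk : 2 * Int.fract x.1 = ((k - 2 ^ (m + 1) * ⌊x.1⌋ : ℤ) : ℝ) / 2 ^ m := by
      have := Int.self_sub_floor x.1
      rw [← this]
      nth_rw 1 [hx]
      push_cast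
      field_simp
      ring
    have h0 := Int.fract_nonneg x.1
    have h1 := Int.fract_lt_one x.1
    suffices h : ∃ g, act ⟨0, by simpa using isDyadic_intCast 0⟩ g = y by
      obtain ⟨g, hg⟩ := h
      exact ⟨g * (translate (-⌊x.1⌋))⁻¹, by rw [act_mul, hg, hy, act_act_inv]⟩
    rcases le_total (2 * Int.fract x.1) 1 with h | h
    · have hz : IsDyadic (2 * Int.fract x.1) := ⟨_, _, hk⟩
      obtain ⟨g, hg⟩ := ih _ ⟨_, hz⟩ hk
      refine ⟨g * stretch⁻¹, Subtype.ext ?_⟩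
      rw [act_mul, hg, act_stretch_inv_val (by positivity) (by dsimp only; linarith), hy']
      ring
    · have hk' : 2 * Int.fract x.1 - 1 =
          ((k - 2 ^ (m + 1) * ⌊x.1⌋ - 2 ^ m : ℤ) : ℝ) / 2 ^ m := by
        rw [hk]
        push_cast
        field_simp
      have hz : IsDyadic (2 * Int.fract x.1 - 1) := ⟨_, _, hk'⟩
      obtain ⟨g, hg⟩ := ih _ ⟨_, hz⟩ hk'
      refine ⟨g * upperHalf, Subtype.ext ?_⟩
      rw [act_mul, hg, act_upperHalf_val (by dsimp only; linarith) (by dsimp only; linarith), hy']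
      ring

theorem exists_act_eq (x y : DyadicPoint) : ∃ g, act x g = y := by
  obtain ⟨k, m, hx⟩ := x.2
  obtain ⟨l, n, hy⟩ := y.2
  obtain ⟨g, hg⟩ := exists_act_eq_of_pow m k x hx
  obtain ⟨h, hh⟩ := exists_act_eq_of_pow n l y hy
  exact ⟨g⁻¹ * h, by rw [act_mul, ← hg, act_act_inv, hh]⟩

/-! ### The Koopman representation and the Dirichlet inequality -/

/-- The Hilbert space of square summable functions on the dyadic rationals. -/
abbrev L2 : Type := lp (fun _ : DyadicPoint => ℝ) 2

/-- The action of an element of Thompson's group as a permutation of the dyadic rationals. -/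
def actEquiv (g : ThompsonF) : DyadicPoint ≃ DyadicPoint where
  toFun γ := act γ g
  invFun γ := act γ g⁻¹
  left_inv γ := act_act_inv γ g
  right_inv γ := act_inv_act γ g

/-- The unitary operator `u ↦ u (·.g)`. -/
noncomputable def koopman (g : ThompsonF) : L2 →ₗᵢ[ℝ] L2 where
  toFun u := ⟨fun γ => u (act γ g), by
    have h := (memℓp_gen_iff (by norm_num)).1 (lp.memℓp u)
    exact (memℓp_gen_iff (by norm_num)).2 ((actEquiv g).summable_iff.2 h)⟩
  map_add' _ _ := rfl
  map_smul' _ _ := rfl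
  norm_map' u := by
    change ‖(⟨fun γ => u (act γ g), _⟩ : L2)‖ = ‖u‖
    rw [lp.norm_eq_tsum_rpow (by norm_num), lp.norm_eq_tsum_rpow (by norm_num)]
    congr 1
    exact (actEquiv g).tsum_eq fun γ => ‖u γ‖ ^ (2 : ENNReal).toReal

theorem koopman_apply (g : ThompsonF) (u : L2) (γ : DyadicPoint) :
    koopman g u γ = u (act γ g) := rfl

/-- Displacements are subadditive because `koopman` is multiplicative (the action is on the right)
and isometric. -/
theorem norm_sub_koopman_mul_le (g h : ThompsonF) (u : L2) :
    ‖u - koopman (g * h) u‖ ≤ ‖u - koopman g u‖ + ‖u - koopman h u‖ := by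
  have e : u - koopman (g * h) u = (u - koopman g u) + koopman g (u - koopman h u) := by
    rw [map_sub]
    change _ = u - koopman g u + (koopman g u - koopman (g * h) u)
    abel
  rw [e, ← (koopman g).norm_map (u - koopman h u)]
  exact norm_add_le _ _

theorem sum_L2_apply {ι : Type*} (s : Finset ι) (f : ι → L2) (γ : DyadicPoint) :
    (∑ i ∈ s, f i) γ = ∑ i ∈ s, f i γ := by
  rw [lp.coeFn_sum]
  exact Finset.sum_apply γ s fun i => (f i : DyadicPoint → ℝ)

theorem abs_apply_le_norm (u : L2) (γ : DyadicPoint) : |u γ| ≤ ‖u‖ :=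
  lp.norm_apply_le_norm (by norm_num) u γ

theorem sum_sq_le_norm_sq (u : L2) (s : Finset DyadicPoint) : ∑ γ ∈ s, u γ ^ 2 ≤ ‖u‖ ^ 2 := by
  have := lp.sum_rpow_le_norm_rpow (p := 2) (by norm_num) u s
  simpa using this

/-- The dyadic rational `(2 * k + 1) / 2 ^ (n + 1)`, the vertex number `k` at level `n` of the
binary tree rooted at `1 / 2`. -/
noncomputable def vertex (n k : ℕ) : DyadicPoint :=
  ⟨(2 * k + 1) / 2 ^ (n + 1), 2 * k + 1, n + 1, by push_cast; rfl⟩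

theorem vertex_injective (n : ℕ) : Function.Injective (vertex n) := by
  intro k l h
  have h' : ((2 * k + 1 : ℝ)) / 2 ^ (n + 1) = (2 * l + 1) / 2 ^ (n + 1) := congrArg Subtype.val h
  rw [div_left_inj' (by positivity)] at h'
  have : (k : ℝ) = l := by linarith
  exact_mod_cast this

theorem vertex_pos (n k : ℕ) : 0 ≤ (vertex n k).1 := by
  change (0 : ℝ) ≤ (2 * k + 1) / 2 ^ (n + 1)
  positivity

theorem vertex_le_one {n k : ℕ} (h : k < 2 ^ n) : (vertex n k).1 ≤ 1 := by
  change ((2 * k + 1 : ℝ)) / 2 ^ (n + 1) ≤ 1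
  rw [div_le_one (by positivity)]
  have : 2 * k + 1 ≤ 2 ^ (n + 1) := by rw [pow_succ]; omega
  exact_mod_cast this

theorem act_vertex_stretch_inv {n k : ℕ} (h : k < 2 ^ n) :
    act (vertex n k) stretch⁻¹ = vertex (n + 1) k := by
  refine Subtype.ext ?_
  rw [act_stretch_inv_val (vertex_pos n k) ((vertex_le_one h).trans one_le_two)]
  simp only [vertex]
  rw [pow_succ _ (n + 1), div_div]

theorem act_vertex_upperHalf {n k : ℕ} (h : k < 2 ^ n) :
    act (vertex n k) upperHalf = vertex (n + 1) (2 ^ n + k) := by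
  refine Subtype.ext ?_
  rw [act_upperHalf_val (vertex_pos n k) (vertex_le_one h)]
  simp only [vertex]
  push_cast
  field_simp
  ring

/-- The sum of a function over a level of the binary tree. -/
noncomputable def levelSum (u : L2) (n : ℕ) : ℝ := ∑ k ∈ Finset.range (2 ^ n), u (vertex n k)

/-- The images of level `n` under `x/2` and `(x+1)/2` are the vertices of level `n + 1` with numbers
below `2 ^ n` and from `2 ^ n` on. -/
theorem levelSum_succ (u : L2) (n : ℕ) :
    levelSum u (n + 1) = levelSum (koopman stretch⁻¹ u) n + levelSum (koopman upperHalf u) n := by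
  rw [levelSum, pow_succ, mul_two, Finset.sum_range_add, levelSum, levelSum]
  congr 1 <;> refine Finset.sum_congr rfl fun k hk => ?_
  · rw [koopman_apply, act_vertex_stretch_inv (Finset.mem_range.1 hk)]
  · rw [koopman_apply, act_vertex_upperHalf (Finset.mem_range.1 hk)]

/-- Cauchy–Schwarz over the `2 ^ n` distinct vertices of the level. -/
theorem abs_levelSum_le (u : L2) (n : ℕ) : |levelSum u n| ≤ √2 ^ n * ‖u‖ := by
  refine abs_le_of_sq_le_sq ?_ (by positivity)
  have h1 : levelSum u n ^ 2 ≤ 2 ^ n * ∑ k ∈ Finset.range (2 ^ n), u (vertex n k) ^ 2 := by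
    simpa [levelSum] using sq_sum_le_card_mul_sum_sq (s := Finset.range (2 ^ n)) (f := fun k => u (vertex n k))
  have h2 : ∑ k ∈ Finset.range (2 ^ n), u (vertex n k) ^ 2 ≤ ‖u‖ ^ 2 := by
    have := sum_sq_le_norm_sq u ((Finset.range (2 ^ n)).map ⟨_, vertex_injective n⟩)
    simpa [Finset.sum_map] using this
  calc levelSum u n ^ 2 ≤ 2 ^ n * ‖u‖ ^ 2 := h1.trans (by gcongr)
    _ = (√2 ^ n * ‖u‖) ^ 2 := by
      rw [mul_pow, ← pow_mul, mul_comm n 2, pow_mul, Real.sq_sqrt (by norm_num)]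

theorem levelSum_sub (u v : L2) (n : ℕ) : levelSum (u - v) n = levelSum u n - levelSum v n := by
  simp [levelSum]

theorem abs_levelSum_sub_half_le (u : L2) (n : ℕ) :
    |levelSum u n - levelSum u (n + 1) / 2| ≤
      √2 ^ n * (‖u - koopman stretch⁻¹ u‖ + ‖u - koopman upperHalf u‖) := by
  have h1 := abs_levelSum_le (u - koopman stretch⁻¹ u) n
  have h2 := abs_levelSum_le (u - koopman upperHalf u) n
  rw [levelSum_sub] at h1 h2
  rw [levelSum_succ]
  have h3 := abs_add_le (levelSum u n - levelSum (koopman stretch⁻¹ u) n)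
    (levelSum u n - levelSum (koopman upperHalf u) n)
  have e : levelSum u n - (levelSum (koopman stretch⁻¹ u) n + levelSum (koopman upperHalf u) n) / 2 =
    ((levelSum u n - levelSum (koopman stretch⁻¹ u) n) +
      (levelSum u n - levelSum (koopman upperHalf u) n)) / 2 := by ring
  rw [e, abs_div, abs_two]
  have := abs_nonneg (levelSum u n - levelSum (koopman stretch⁻¹ u) n +
    (levelSum u n - levelSum (koopman upperHalf u) n))
  linarith

/-- The averages `levelSum u n / 2 ^ n` start at the root value and tend to `0`, since level sums
grow at most like `√2 ^ n`. Consecutive averages differ by at most `(√2 / 2) ^ n * E`, so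
telescoping leaves a geometric series, whose sum is the constant. -/
theorem abs_apply_root_le (u : L2) : |u (vertex 0 0)| ≤
    (1 - √2 / 2)⁻¹ * (‖u - koopman stretch⁻¹ u‖ + ‖u - koopman upperHalf u‖) := by
  set E := ‖u - koopman stretch⁻¹ u‖ + ‖u - koopman upperHalf u‖ with hE
  have hE0 : 0 ≤ E := by positivity
  have hr0 : 0 ≤ √2 / 2 := by positivity
  have hr1 : √2 / 2 < 1 := by
    rw [div_lt_one two_pos, Real.sqrt_lt' two_pos]
    norm_num
  have key : ∀ N, |u (vertex 0 0)| ≤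
      (∑ n ∈ Finset.range N, (√2 / 2) ^ n) * E + |levelSum u N| / 2 ^ N := by
    intro N
    induction N with
    | zero => simp [levelSum]
    | succ N ih =>
      refine ih.trans ?_
      rw [Finset.sum_range_succ, add_mul, add_assoc]
      gcongr
      have h1 := abs_levelSum_sub_half_le u N
      have h2 := abs_sub_abs_le_abs_sub (levelSum u N) (levelSum u (N + 1) / 2)
      rw [abs_div, abs_two] at h2
      have h3 : |levelSum u N| ≤ √2 ^ N * E + |levelSum u (N + 1)| / 2 := by linarith
      calc |levelSum u N| / 2 ^ N ≤ (√2 ^ N * E + |levelSum u (N + 1)| / 2) / 2 ^ N := by gcongr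
        _ = _ := by rw [div_pow, pow_succ]; field_simp
  have key2 : ∀ N, |u (vertex 0 0)| ≤ (1 - √2 / 2)⁻¹ * E + (√2 / 2) ^ N * ‖u‖ := by
    intro N
    refine (key N).trans (add_le_add ?_ ?_)
    · gcongr
      rw [← tsum_geometric_of_lt_one hr0 hr1]
      exact (summable_geometric_of_lt_one hr0 hr1).sum_le_tsum _ fun n _ => by positivity
    · rw [div_pow, div_mul_eq_mul_div]
      gcongr
      exact abs_levelSum_le u N
  have lim : Tendsto (fun N : ℕ => (1 - √2 / 2)⁻¹ * E + (√2 / 2) ^ N * ‖u‖) atTop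
      (𝓝 ((1 - √2 / 2)⁻¹ * E + 0 * ‖u‖)) :=
    ((tendsto_pow_atTop_nhds_zero_of_lt_one hr0 hr1).mul_const _).const_add _
  have := ge_of_tendsto' lim key2
  simpa using this

/-! ### Dirichlet form, Markov operator and Green function. -/

section Dirichlet

/-- The Dirichlet form of a finitely supported weight `w` on Thompson's group acting on the dyadic
rationals. -/
noncomputable def dirichletForm (S : Finset ThompsonF) (w : ThompsonF → ℝ) (u : L2) : ℝ :=
  ∑ h ∈ S, w h * ‖u - koopman h u‖ ^ 2

variable {S : Finset ThompsonF} {w : ThompsonF → ℝ}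

/-- An element `h` of `S` contributes a single term of the form, whence the constant `1 / √(w h)`;
for products the constants add up. -/
theorem exists_norm_sub_koopman_le (hw : ∀ h ∈ S, 0 < w h)
    (hS : Subsemigroup.closure (S : Set ThompsonF) = ⊤) (g : ThompsonF) :
    ∃ K, ∀ u, ‖u - koopman g u‖ ≤ K * √(dirichletForm S w u) := by
  have hg : g ∈ Subsemigroup.closure (S : Set ThompsonF) := by rw [hS]; trivial
  induction hg using Subsemigroup.closure_induction with
  | mem h hh =>
    have hh : h ∈ S := hh
    refine ⟨√(w h)⁻¹, fun u => ?_⟩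
    rw [← Real.sqrt_mul (inv_nonneg.2 (hw h hh).le)]
    refine Real.le_sqrt_of_sq_le ?_
    rw [le_inv_mul_iff₀ (hw h hh)]
    exact Finset.single_le_sum (f := fun h => w h * ‖u - koopman h u‖ ^ 2)
      (fun i hi => mul_nonneg (hw i hi).le (sq_nonneg _)) hh
  | mul g h _ _ ihg ihh =>
    obtain ⟨K, hK⟩ := ihg
    obtain ⟨K', hK'⟩ := ihh
    refine ⟨K + K', fun u => (norm_sub_koopman_mul_le g h u).trans ?_⟩
    rw [add_mul]
    exact add_le_add (hK u) (hK' u)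

/-- Values of square summable functions are controlled by the Dirichlet form: the Schreier graph
is transient. -/
theorem exists_abs_apply_le (hw : ∀ h ∈ S, 0 < w h)
    (hS : Subsemigroup.closure (S : Set ThompsonF) = ⊤) (γ : DyadicPoint) :
    ∃ K, ∀ u : L2, |u γ| ≤ K * √(dirichletForm S w u) := by
  obtain ⟨g, hg⟩ := exists_act_eq (vertex 0 0) γ
  obtain ⟨K, hK⟩ := exists_norm_sub_koopman_le hw hS g
  obtain ⟨Ka, ha⟩ := exists_norm_sub_koopman_le hw hS stretch⁻¹
  obtain ⟨Kb, hb⟩ := exists_norm_sub_koopman_le hw hS upperHalf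
  refine ⟨(1 - √2 / 2)⁻¹ * (Ka + Kb) + K, fun u => ?_⟩
  -- As `g` carries the root to `γ`, the displacement under `g` bounds the difference of the two
  -- values.
  have h1 := (abs_apply_le_norm (u - koopman g u) (vertex 0 0)).trans (hK u)
  have e : (u - koopman g u) (vertex 0 0) = u (vertex 0 0) - u γ := by
    rw [← hg]
    rfl
  rw [e, abs_sub_comm] at h1
  have h2 := abs_sub_abs_le_abs_sub (u γ) (u (vertex 0 0))
  have hr1 : √2 / 2 < 1 := by
    rw [div_lt_one two_pos, Real.sqrt_lt' two_pos]
    norm_num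
  have h3 : |u (vertex 0 0)| ≤ (1 - √2 / 2)⁻¹ * ((Ka + Kb) * √(dirichletForm S w u)) := by
    refine (abs_apply_root_le u).trans ?_
    have : 0 ≤ (1 - √2 / 2)⁻¹ := inv_nonneg.2 (by linarith)
    rw [add_mul]
    exact mul_le_mul_of_nonneg_left (add_le_add (ha u) (hb u)) this
  rw [add_mul, mul_assoc]
  linarith

/-- The Markov operator `u ↦ ∑ w h • u (·.h)`. -/
noncomputable def markov (S : Finset ThompsonF) (w : ThompsonF → ℝ) : L2 →ₗ[ℝ] L2 :=
  ∑ h ∈ S, w h • (koopman h).toLinearMap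

theorem markov_eq (u : L2) : markov S w u = ∑ h ∈ S, w h • koopman h u := by
  simp [markov]

theorem markov_apply (u : L2) (γ : DyadicPoint) :
    markov S w u γ = ∑ h ∈ S, w h * u (act γ h) := by
  rw [markov_eq, sum_L2_apply]
  rfl

/-- Only the isometry of each `koopman h` and the total weight `1` enter, so the weight need not be
symmetric. -/
theorem dirichletForm_eq (h1 : ∑ h ∈ S, w h = 1) (u : L2) :
    dirichletForm S w u = 2 * inner ℝ (u - markov S w u) u := by
  have e : ∀ h, ‖u - koopman h u‖ ^ 2 = 2 * (inner ℝ u u - inner ℝ (koopman h u) u) := fun h => by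
    rw [norm_sub_sq_real, (koopman h).norm_map, real_inner_self_eq_norm_sq, real_inner_comm]
    ring
  rw [dirichletForm, inner_sub_left, markov_eq, sum_inner]
  simp_rw [e, real_inner_smul_left]
  rw [mul_sub, Finset.mul_sum]
  conv_rhs => enter [1]; rw [← one_mul (inner ℝ u u), ← h1, Finset.sum_mul, Finset.mul_sum]
  rw [← Finset.sum_sub_distrib]
  exact Finset.sum_congr rfl fun h _ => by ring

/-- The function `δ_γ`. -/
noncomputable def delta (γ : DyadicPoint) : L2 := by
  classical exact lp.single 2 γ 1

open Classical in
theorem delta_apply (γ δ : DyadicPoint) : delta γ δ = if δ = γ then 1 else 0 := by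
  rw [delta, lp.single_apply]
  simp [Pi.single_apply]

theorem inner_delta (γ : DyadicPoint) (u : L2) : inner ℝ (delta γ) u = u γ := by
  rw [delta, lp.inner_single_left]
  simp

theorem iterate_markov_delta_nonneg (hw : ∀ h ∈ S, 0 < w h) (γ : DyadicPoint) (n : ℕ) :
    ∀ δ, 0 ≤ ((markov S w) ^ n) (delta γ) δ := by
  induction n with
  | zero =>
    intro δ
    rw [pow_zero, Module.End.one_apply, delta_apply]
    split_ifs <;> norm_num
  | succ n ih =>
    intro δ
    rw [pow_succ', Module.End.mul_apply, markov_apply]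
    exact Finset.sum_nonneg fun h hh => mul_nonneg (hw h hh).le (ih _)

theorem inner_nonneg_of_nonneg {u v : L2} (hu : ∀ γ, 0 ≤ u γ) (hv : ∀ γ, 0 ≤ v γ) :
    0 ≤ inner ℝ u v := by
  rw [lp.inner_eq_tsum]
  exact tsum_nonneg fun γ => by simpa using mul_nonneg (hv γ) (hu γ)

/-- The Green function is finite. -/
theorem summable_iterate_markov_delta (hw : ∀ h ∈ S, 0 < w h) (h1 : ∑ h ∈ S, w h = 1)
    (hS : Subsemigroup.closure (S : Set ThompsonF) = ⊤) (γ δ : DyadicPoint) :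
    Summable fun n => ((markov S w) ^ n) (delta γ) δ := by
  obtain ⟨K, hK⟩ := exists_abs_apply_le hw hS γ
  obtain ⟨K', hK'⟩ := exists_abs_apply_le hw hS δ
  have hnn := iterate_markov_delta_nonneg hw γ
  refine summable_of_sum_range_le (c := |K'| * √(2 * (2 * K ^ 2))) (fun n => hnn n δ) fun N => ?_
  -- The truncated Green function, to be bounded independently of `N`.
  set u : L2 := ∑ n ∈ Finset.range N, ((markov S w) ^ n) (delta γ) with hu
  have hval : ∀ x, u x = ∑ n ∈ Finset.range N, ((markov S w) ^ n) (delta γ) x := fun x =>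
    sum_L2_apply _ _ x
  have hu0 : ∀ x, 0 ≤ u x := fun x => by
    rw [hval]
    exact Finset.sum_nonneg fun n _ => hnn n x
  have htel : u - markov S w u = delta γ - ((markov S w) ^ N) (delta γ) := by
    rw [hu, map_sum, ← Finset.sum_sub_distrib]
    have := Finset.sum_range_sub' (fun n => ((markov S w) ^ n) (delta γ)) N
    simpa [pow_succ'] using this
  -- Telescoping leaves `delta γ` minus a nonnegative function, whose pairing with `u ≥ 0` can be
  -- dropped.
  have hD : dirichletForm S w u ≤ 2 * u γ := by
    rw [dirichletForm_eq h1, htel, inner_sub_left, inner_delta]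
    have := inner_nonneg_of_nonneg (hnn N) hu0
    linarith
  have hγ : u γ ≤ 2 * K ^ 2 := by
    have h2 := hK u
    rw [abs_of_nonneg (hu0 γ)] at h2
    have hDnn : 0 ≤ dirichletForm S w u :=
      Finset.sum_nonneg fun h hh => mul_nonneg (hw h hh).le (sq_nonneg _)
    -- The form bounds `u γ` and is itself bounded by `2 * u γ`; cancelling one factor gives a bound
    -- free of `N`.
    have h3 : u γ ^ 2 ≤ K ^ 2 * (2 * u γ) := by
      calc u γ ^ 2 ≤ (K * √(dirichletForm S w u)) ^ 2 := pow_le_pow_left₀ (hu0 γ) h2 2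
        _ = K ^ 2 * dirichletForm S w u := by rw [mul_pow, Real.sq_sqrt hDnn]
        _ ≤ _ := by gcongr
    rcases (hu0 γ).eq_or_lt with h0 | h0
    · rw [← h0]; positivity
    · refine le_of_mul_le_mul_right ?_ h0
      linarith
  rw [← hval]
  calc u δ ≤ |u δ| := le_abs_self _
    _ ≤ K' * √(dirichletForm S w u) := hK' u
    _ ≤ |K'| * √(2 * (2 * K ^ 2)) :=
      mul_le_mul (le_abs_self _) (Real.sqrt_le_sqrt (hD.trans (by gcongr)))
        (Real.sqrt_nonneg _) (abs_nonneg _)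

end Dirichlet

/-! ### Random walks -/

section Increments

variable {G : Type*} [MeasurableSpace G]

/-- The law of a sequence of independent `μ`-distributed increments. -/
noncomputable def incrementMeasure (μ : PMF G) : Measure (ℕ → G) :=
  Measure.infinitePi fun _ : ℕ => μ.toMeasure

instance (μ : PMF G) : IsProbabilityMeasure (incrementMeasure μ) := by
  unfold incrementMeasure
  infer_instance

theorem measurePreserving_shift_incrementMeasure (μ : PMF G) :
    MeasurePreserving (fun (h : ℕ → G) k => h (k + 1)) (incrementMeasure μ)
      (incrementMeasure μ) where
  measurable := by fun_prop
  map_eq := Measure.map_infinitePi_infinitePi_of_inj (P := fun _ : ℕ => μ.toMeasure)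
    (f := fun k : ℕ => k + 1) (add_left_injective 1)

variable [DiscreteMeasurableSpace G]

theorem incrementMeasure_eval_preimage (μ : PMF G) (n : ℕ) (A : Set G) :
    incrementMeasure μ {h | h n ∈ A} = μ.toMeasure A :=
  (measurePreserving_eval_infinitePi (fun _ : ℕ => μ.toMeasure) n).measure_preimage
    (MeasurableSet.of_discrete (s := A)).nullMeasurableSet

theorem ae_increment_mem_support (μ : PMF G) :
    ∀ᵐ h ∂incrementMeasure μ, ∀ n, h n ∈ μ.support := by
  refine ae_all_iff.2 fun n => ?_
  change incrementMeasure μ {h | h n ∈ μ.supportᶜ} = 0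
  rw [incrementMeasure_eval_preimage, μ.toMeasure_apply_eq_zero_iff .of_discrete]
  exact disjoint_compl_right

end Increments

section Walk

variable {G : Type*} [Group G]

theorem walk_eq_mul (g : G) (h : ℕ → G) (n : ℕ) : walk g h n = g * walk 1 h n := by
  induction n with
  | zero => simp [walk]
  | succ n ih => rw [walk, walk, ih, mul_assoc]

/-- Splits off the first increment, leaving a walk driven by the shifted increments; stationarity of
the limit law rests on this. -/
theorem walk_one_succ (h : ℕ → G) (n : ℕ) :
    walk 1 h (n + 1) = h 0 * walk 1 (fun k => h (k + 1)) n := by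
  induction n with
  | zero => simp [walk]
  | succ n ih => rw [walk, ih, walk, mul_assoc]

theorem walk_congr {g : G} {h h' : ℕ → G} {n : ℕ} (e : ∀ k < n, h k = h' k) :
    walk g h n = walk g h' n := by
  induction n with
  | zero => rfl
  | succ n ih => rw [walk, walk, ih fun k hk => e k (hk.trans n.lt_succ_self), e n n.lt_succ_self]

variable [MeasurableSpace G] [Countable G] [DiscreteMeasurableSpace G]

theorem measurable_walk_one (n : ℕ) : Measurable fun h : ℕ → G => walk 1 h n :=
  (measurable_pi_apply n).comp (measurable_walk.comp (measurable_const.prodMk measurable_id))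

theorem indepFun_walk (μ : PMF G) (n : ℕ) :
    ProbabilityTheory.IndepFun (fun h : ℕ → G => walk 1 h n) (fun h => h n)
      (incrementMeasure μ) := by
  have hi := ProbabilityTheory.iIndepFun_infinitePi (P := fun _ : ℕ => μ.toMeasure)
    (X := fun _ (g : G) => g) (fun _ => measurable_id)
  have h2 := hi.indepFun_finset (Finset.range n) {n} (by simp) (fun i => measurable_pi_apply i)
  -- The position at time `n` depends only on the increments with index below `n`; the others may be
  -- filled in by `1`.
  let φ : (Finset.range n → G) → G := fun f =>
    walk 1 (fun k => if hk : k ∈ Finset.range n then f ⟨k, hk⟩ else 1) n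
  let ψ : (({n} : Finset ℕ) → G) → G := fun f => f ⟨n, Finset.mem_singleton_self n⟩
  have hφ : Measurable φ := by
    refine (measurable_walk_one n).comp (measurable_pi_iff.2 fun k => ?_)
    by_cases hk : k ∈ Finset.range n
    · simp only [hk, dite_true]
      exact measurable_pi_apply _
    · simp only [hk, dite_false]
      exact measurable_const
  have h3 := h2.comp hφ (show Measurable ψ from measurable_pi_apply _)
  have e : (φ ∘ fun (h : ℕ → G) (i : Finset.range n) => h i) = fun h => walk 1 h n := by
    funext h
    exact walk_congr fun k hk => by simp [hk]
  rw [e] at h3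
  exact h3

/-- A measurable property holds almost surely along the paths of the random walk if it does so
for each starting point. -/
theorem ae_pathMeasure_of_forall {μ : PMF G} {p : (ℕ → G) → Prop} (hp : MeasurableSet {x | p x})
    (h : ∀ g, ∀ᵐ s ∂incrementMeasure μ, p (walk g s)) (θ : Measure G) :
    ∀ᵐ x ∂pathMeasure μ θ, p x := by
  rw [pathMeasure, ae_map_iff measurable_walk.aemeasurable hp]
  exact (Measure.ae_prod_iff_ae_ae (measurable_walk hp)).2 (Eventually.of_forall h)

theorem pathMeasure_dirac_one (μ : PMF G) :
    pathMeasure μ (Measure.dirac 1) = (incrementMeasure μ).map (walk 1) := by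
  rw [pathMeasure, Measure.dirac_prod, Measure.map_map measurable_walk (by fun_prop)]
  rfl

end Walk

/-! ### Transience of the action on dyadic rationals -/

section Transience

variable {μ : PMF ThompsonF}

theorem sum_toReal_eq_one (hfin : μ.support.Finite) : ∑ h ∈ hfin.toFinset, (μ h).toReal = 1 := by
  have h1 := μ.tsum_coe
  rw [tsum_eq_sum (s := hfin.toFinset)
    fun h hh => (μ.apply_eq_zero_iff h).2 fun h' => hh (hfin.mem_toFinset.2 h')] at h1
  rw [← ENNReal.toReal_sum fun h _ => μ.apply_ne_top h, h1, ENNReal.toReal_one]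

theorem toReal_pos_of_mem (hfin : μ.support.Finite) {h : ThompsonF} (hh : h ∈ hfin.toFinset) :
    0 < (μ h).toReal :=
  ENNReal.toReal_pos ((μ.mem_support_iff h).1 (hfin.mem_toFinset.1 hh)) (μ.apply_ne_top h)

/-- Powers of the Markov operator are transition probabilities. The induction conditions on the last
increment `k`, which must carry `δ.k⁻¹` to `δ`. -/
theorem iterate_markov_delta_eq (hfin : μ.support.Finite) (n : ℕ) (γ : DyadicPoint) :
    ∀ δ, ((markov hfin.toFinset fun h => (μ h).toReal) ^ n) (delta δ) γ =
      (incrementMeasure μ).real {h | act γ (walk 1 h n) = δ} := by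
  induction n with
  | zero =>
    intro δ
    rw [pow_zero, Module.End.one_apply, delta_apply]
    by_cases e : γ = δ <;> simp [walk, act_one, e]
  | succ n ih =>
    intro δ
    have hk : ∀ k, koopman k (delta δ) = delta (act δ k⁻¹) := by
      classical
      intro k
      ext ε
      rw [koopman_apply, delta_apply, delta_apply]
      exact if_congr act_eq_iff rfl rfl
    -- The equality is only almost sure, since the union runs over increments in the support.
    have h1 : {h | act γ (walk 1 h (n + 1)) = δ} =ᵐ[incrementMeasure μ]
        ⋃ k ∈ hfin.toFinset, {h | act γ (walk 1 h n) = act δ k⁻¹} ∩ {h | h n = k} := by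
      filter_upwards [ae_increment_mem_support μ] with h hh
      refine propext ?_
      change act γ (walk 1 h n * h n) = δ ↔ _
      rw [act_mul, act_eq_iff]
      refine Iff.trans ?_ Set.mem_iUnion₂.symm
      exact ⟨fun e => ⟨h n, hfin.mem_toFinset.2 (hh n), e, rfl⟩, fun ⟨k, _, e, e'⟩ => by
        rw [show h n = k from e']
        exact e⟩
    rw [measureReal_congr h1, measureReal_biUnion_finset]
    · rw [pow_succ, Module.End.mul_apply, markov_eq, map_sum, sum_L2_apply]
      refine Finset.sum_congr rfl fun k _ => ?_
      rw [map_smul, hk]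
      change (μ k).toReal * _ = _
      rw [ih]
      have hind := (indepFun_walk μ n).measure_inter_preimage_eq_mul
        {g | act γ g = act δ k⁻¹} {k} .of_discrete .of_discrete
      have hk' : incrementMeasure μ ((fun h => h n) ⁻¹' {k}) = μ k := by
        rw [← μ.toMeasure_apply_singleton k .of_discrete]
        exact incrementMeasure_eval_preimage μ n {k}
      rw [hk'] at hind
      rw [measureReal_def, measureReal_def, ← ENNReal.toReal_mul, mul_comm]
      exact congrArg ENNReal.toReal hind.symm
    · intro k _ l _ hkl
      refine Set.disjoint_left.2 fun h h1 h2 => hkl ?_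
      exact (show h n = k from h1.2).symm.trans h2.2
    · intro k _
      have hm : MeasurableSet ((fun h : ℕ → ThompsonF => h n) ⁻¹' {k}) :=
        measurable_pi_apply n .of_discrete
      exact (measurable_walk_one n (.of_discrete (s := {g | act γ g = act δ k⁻¹}))).inter hm

variable (hfin : μ.support.Finite) (hnd : StrictlyNondegenerate μ)
include hfin hnd

/-- Borel–Cantelli: the finite Green function is the sum of the visiting probabilities. -/
theorem ae_eventually_act_walk_ne (γ δ : DyadicPoint) :
    ∀ᵐ h ∂incrementMeasure μ, ∀ᶠ n in atTop, act γ (walk 1 h n) ≠ δ := by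
  have hs := summable_iterate_markov_delta (S := hfin.toFinset) (w := fun h => (μ h).toReal)
    (fun h hh => toReal_pos_of_mem hfin hh) (sum_toReal_eq_one hfin)
    (by rw [hfin.coe_toFinset]; exact hnd) δ γ
  simp_rw [iterate_markov_delta_eq hfin] at hs
  refine ae_eventually_notMem (s := fun n => {h | act γ (walk 1 h n) = δ}) ?_
  have := hs.tsum_ofReal_ne_top
  simpa only [measureReal_def, ENNReal.ofReal_toReal (measure_ne_top _ _)] using this

/-- Once the orbit of `γ` has left the finite union of the supports for good, no further increment
changes the value at `γ`. -/
theorem ae_exists_tendsto_jumpConfig (g : ThompsonF) :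
    ∀ᵐ s ∂incrementMeasure μ, ∀ γ, ∃ c,
      Tendsto (fun n => jumpConfig (walk g s n) γ) atTop (𝓝 c) := by
  have h1 : ∀ᵐ s ∂incrementMeasure μ, ∀ γ δ, ∀ᶠ n in atTop, act γ (walk 1 s n) ≠ δ :=
    ae_all_iff.2 fun γ => ae_all_iff.2 fun δ => ae_eventually_act_walk_ne hfin hnd γ δ
  have hK : (⋃ h ∈ μ.support, Function.support (jumpConfig h)).Finite :=
    hfin.biUnion fun h _ => finite_support_jumpConfig h
  filter_upwards [h1, ae_increment_mem_support μ] with s hs hsupp γ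
  have h2 : ∀ᶠ n in atTop, ∀ δ ∈ ⋃ h ∈ μ.support, Function.support (jumpConfig h),
      act (act γ g) (walk 1 s n) ≠ δ :=
    (eventually_all_finite hK).2 fun δ _ => hs (act γ g) δ
  obtain ⟨N, hN⟩ := eventually_atTop.1 h2
  refine ⟨jumpConfig (walk g s N) γ, tendsto_atTop_of_eventually_const (i₀ := N) fun n hn => ?_⟩
  induction n, hn using Nat.le_induction with
  | base => rfl
  | succ n hn ih =>
    rw [walk, jumpConfig_mul, ih, add_eq_left]
    by_contra h0
    refine hN n hn (act γ (walk g s n)) ?_ (by rw [walk_eq_mul g, act_mul])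
    exact Set.mem_biUnion (hsupp n) h0

end Transience

/-! ### The limit configuration -/

/-- The pointwise limit of the configurations along a path. -/
noncomputable def limitConfig (x : ℕ → ThompsonF) : Config := fun γ =>
  limUnder atTop fun n => jumpConfig (x n) γ

theorem measurable_jumpConfig_apply (γ : DyadicPoint) (n : ℕ) :
    Measurable fun x : ℕ → ThompsonF => jumpConfig (x n) γ :=
  (Measurable.of_discrete (f := fun g : ThompsonF => jumpConfig g γ)).comp (measurable_pi_apply n)

theorem measurable_limitConfig_apply (γ : DyadicPoint) :
    Measurable fun x : ℕ → ThompsonF => limitConfig x γ :=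
  (StronglyMeasurable.limUnder fun n =>
    (measurable_jumpConfig_apply γ n).stronglyMeasurable).measurable

theorem measurable_limitConfig : Measurable limitConfig :=
  measurable_pi_iff.2 measurable_limitConfig_apply

/-- This holds for every path, convergent or not, because `limUnder` sees only the image of `atTop`.
Hence the map descends to the quotient with no exceptional null set. -/
theorem limitConfig_shift (x : ℕ → ThompsonF) : limitConfig (shift x) = limitConfig x := by
  funext γ
  change lim (map ((fun n => jumpConfig (x n) γ) ∘ fun n => n + 1) atTop) = lim (map _ atTop)
  rw [← Filter.map_map, map_add_atTop_eq_nat]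

theorem limitConfig_shift_iterate (m : ℕ) (x : ℕ → ThompsonF) :
    limitConfig (shift^[m] x) = limitConfig x := by
  induction m generalizing x with
  | zero => rfl
  | succ m ih => rw [Function.iterate_succ_apply, ih, limitConfig_shift]

/-- The map from the Poisson boundary to the space of configurations. -/
noncomputable def boundaryConfig : PoissonBoundary ThompsonF → Config :=
  Quotient.lift limitConfig fun x y ⟨m, n, h⟩ => by
    rw [← limitConfig_shift_iterate m x, h, limitConfig_shift_iterate]

theorem boundaryConfig_bnd (x : ℕ → ThompsonF) : boundaryConfig (bnd x) = limitConfig x := rfl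

theorem measurable_boundaryConfig : Measurable boundaryConfig := fun _ hA =>
  measurableSet_boundary_iff.2 (measurable_limitConfig hA)

/-- All pointwise limits along the path exist. -/
def Converges (x : ℕ → ThompsonF) : Prop :=
  ∀ γ, ∃ c, Tendsto (fun n => jumpConfig (x n) γ) atTop (𝓝 c)

theorem Converges.tendsto {x : ℕ → ThompsonF} (h : Converges x) (γ : DyadicPoint) :
    Tendsto (fun n => jumpConfig (x n) γ) atTop (𝓝 (limitConfig x γ)) :=
  tendsto_nhds_limUnder (h γ)

theorem Converges.limitConfig_mul {x : ℕ → ThompsonF} (h : Converges x) (g : ThompsonF) :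
    limitConfig (fun n => g * x n) = g • limitConfig x := by
  funext γ
  refine Tendsto.limUnder_eq ?_
  simp_rw [jumpConfig_mul]
  exact (h.tendsto (act γ g)).const_add _

theorem measurableSet_converges : MeasurableSet {x | Converges x} := by
  simp only [Converges, Set.ofPred_forall]
  exact .iInter fun γ => measurableSet_exists_tendsto (measurable_jumpConfig_apply γ)

/-! ### The limit configuration as a boundary map. -/

section Boundary

variable {μ : PMF ThompsonF} (hfin : μ.support.Finite) (hnd : StrictlyNondegenerate μ)
include hfin hnd

theorem ae_converges (θ : Measure ThompsonF) : ∀ᵐ x ∂pathMeasure μ θ, Converges x :=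
  ae_pathMeasure_of_forall measurableSet_converges (ae_exists_tendsto_jumpConfig hfin hnd) θ

theorem isBoundaryMap_boundaryConfig : IsBoundaryMap μ boundaryConfig where
  measurable := measurable_boundaryConfig
  equivariant g := by
    refine (ae_map_iff measurable_bnd.aemeasurable ?_).2 ?_
    -- The set where equivariance holds is measurable, being a countable intersection over the
    -- dyadic points.
    · refine measurableSet_boundary_iff.2 ?_
      have e : bnd ⁻¹' {ξ : PoissonBoundary ThompsonF |
          boundaryConfig (g • ξ) = g • boundaryConfig ξ} =
          ⋂ γ, {x | limitConfig (fun n => g * x n) γ =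
            jumpConfig g γ + limitConfig x (act γ g)} := by
        ext x
        simp only [Set.mem_preimage, Set.mem_ofPred_eq, Set.mem_iInter, smul_bnd,
          boundaryConfig_bnd]
        exact funext_iff
      rw [e]
      have hm : Measurable fun (x : ℕ → ThompsonF) n => g * x n :=
        measurable_pi_iff.2 fun n =>
          (Measurable.of_discrete (f := fun k : ThompsonF => g * k)).comp (measurable_pi_apply n)
      exact .iInter fun γ => measurableSet_eq_fun ((measurable_limitConfig_apply γ).comp hm)
        ((measurable_limitConfig_apply (act γ g)).const_add _)
    · filter_upwards [ae_converges hfin hnd Measure.count] with x hx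
      exact hx.limitConfig_mul g

theorem isMuBoundary_limitConfig :
    IsMuBoundary μ ((pathMeasure μ (Measure.dirac 1)).map limitConfig) := by
  refine ⟨boundaryConfig, isBoundaryMap_boundaryConfig hfin hnd, ?_⟩
  rw [harmonicMeasure, boundaryMeasure, Measure.map_map measurable_boundaryConfig measurable_bnd]
  rfl

end Boundary

/-! ### Non-triviality -/

theorem IsTrivialMeasure.map {A B : Type*} [MeasurableSpace A] [MeasurableSpace B]
    {m : Measure A} (hm : IsTrivialMeasure m) {f : A → B} (hf : Measurable f) :
    IsTrivialMeasure (m.map f) := fun s hs => by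
  rw [Measure.map_apply hf hs, Measure.map_apply hf hs.compl]
  exact hm _ (hf hs)

/-- A trivial probability measure on the space of configurations is a point measure. -/
theorem IsTrivialMeasure.exists_ae_eq {m : Measure Config} [IsProbabilityMeasure m]
    (hm : IsTrivialMeasure m) : ∃ c, ∀ᵐ C ∂m, C = c := by
  have h : ∀ γ : DyadicPoint, ∃ k : ℤ, ∀ᵐ C : Config ∂m, C γ = k := by
    intro γ
    have hmeas : ∀ k : ℤ, MeasurableSet {C : Config | C γ = k} := fun k =>
      measurable_pi_apply (X := fun _ : DyadicPoint => ℤ) γ (measurableSet_singleton k)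
    by_contra hne
    -- If no value had full measure, triviality would make all of them null, yet countably many
    -- cover the space.
    have h0 : ∀ k : ℤ, m {C : Config | C γ = k} = 0 := fun k =>
      (hm _ (hmeas k)).resolve_right fun h => hne ⟨k, h⟩
    have hu : (⋃ k : ℤ, {C : Config | C γ = k}) = Set.univ :=
      Set.eq_univ_of_forall fun C => Set.mem_iUnion.2 ⟨C γ, rfl⟩
    have := measure_iUnion_null h0
    rw [hu, measure_univ] at this
    exact one_ne_zero this
  choose c hc using h
  refine ⟨c, ?_⟩
  filter_upwards [ae_all_iff.2 hc] with C hC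
  exact funext hC

theorem jumpConfig_stretch_zero :
    jumpConfig stretch ⟨0, by simpa using isDyadic_intCast 0⟩ = 1 :=
  jumpConfig_eq (m := 0) (n := 1) affineLeft_stretchFun_zero affineRight_stretchFun_zero

/-- No configuration is fixed by the whole group. -/
theorem exists_smul_ne (c : Config) : ∃ g : ThompsonF, g • c ≠ c := by
  refine ⟨stretch, fun h => ?_⟩
  have h0 := congrFun h ⟨0, by simpa using isDyadic_intCast 0⟩
  have e : act ⟨0, by simpa using isDyadic_intCast 0⟩ stretch =
      ⟨0, by simpa using isDyadic_intCast 0⟩ :=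
    Subtype.ext (by rw [act_stretch_val]; exact stretchFun_of_nonpos le_rfl)
  rw [smul_config_apply, jumpConfig_stretch_zero, e] at h0
  omega

theorem not_isTrivialMeasure_limitConfig {μ : PMF ThompsonF} (hfin : μ.support.Finite)
    (hnd : StrictlyNondegenerate μ) :
    ¬ IsTrivialMeasure ((pathMeasure μ (Measure.dirac 1)).map limitConfig) := by
  intro ht
  have hw : Measurable (walk 1 : (ℕ → ThompsonF) → ℕ → ThompsonF) :=
    measurable_walk.comp (measurable_const.prodMk measurable_id)
  rw [pathMeasure_dirac_one, Measure.map_map measurable_limitConfig hw] at ht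
  have hm := measurable_limitConfig.comp hw
  have : IsProbabilityMeasure ((incrementMeasure μ).map (limitConfig ∘ walk 1)) :=
    Measure.isProbabilityMeasure_map hm.aemeasurable
  obtain ⟨c, hc⟩ := ht.exists_ae_eq
  have hc1 : ∀ᵐ s ∂incrementMeasure μ, limitConfig (walk 1 s) = c :=
    ae_of_ae_map hm.aemeasurable hc
  -- The shifted increments have the same law, so their walk also converges to `c` almost surely.
  have hc2 := (measurePreserving_shift_incrementMeasure μ).quasiMeasurePreserving.ae
    (hc1.and (ae_exists_tendsto_jumpConfig hfin hnd 1))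
  have hfix : ∀ h ∈ μ.support, h • c = c := by
    intro h hh
    have hpos : incrementMeasure μ {s | s 0 ∈ ({h} : Set ThompsonF)} ≠ 0 := by
      rw [incrementMeasure_eval_preimage, μ.toMeasure_apply_singleton h .of_discrete]
      exact hh
    have hfreq : ∃ᶠ s in ae (incrementMeasure μ), s 0 = h := frequently_ae_iff.2 hpos
    -- An event of positive probability meets the almost sure ones: some path has first increment
    -- `h`, and both it and its remainder have limit `c`.
    obtain ⟨s, hs, e1, e2, e3⟩ := (hfreq.and_eventually (hc1.and hc2)).exists
    have e4 : shift (walk 1 s) = fun n => h * walk 1 (fun k => s (k + 1)) n := by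
      funext n
      rw [← hs, ← walk_one_succ]
      rfl
    rw [← limitConfig_shift, e4, Converges.limitConfig_mul e3, e2] at e1
    exact e1
  obtain ⟨g, hg⟩ := exists_smul_ne c
  have hmem : g ∈ Subsemigroup.closure μ.support := by
    rw [show Subsemigroup.closure μ.support = ⊤ from hnd]
    trivial
  refine hg ?_
  clear hg
  -- The stabilizer of `c` is closed under products, so generation as a semigroup is enough.
  induction hmem using Subsemigroup.closure_induction with
  | mem h hh => exact hfix h hh
  | mul a b _ _ ha hb => rw [mul_smul, hb, ha]

end ThompsonWalk

/-! ### Assembly of the theorem. -/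

open ThompsonWalk
theorem mainTheorem1 (μ : PMF ThompsonF) (hfin : μ.support.Finite)
    (hnd : StrictlyNondegenerate μ) :
    ∃ limitConfig : (ℕ → ThompsonF) → Config,
      Measurable limitConfig ∧
      (∀ᵐ x ∂(pathMeasure μ (Measure.dirac 1)), ∀ γ : DyadicPoint,
        Tendsto (fun n => jumpConfig (x n) γ) atTop (𝓝 (limitConfig x γ))) ∧
      (∃ π : PoissonBoundary ThompsonF → Config, IsBoundaryMap μ π ∧
        ∀ᵐ x ∂(pathMeasure μ (Measure.dirac 1)), π (bnd x) = limitConfig x) ∧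
      IsMuBoundary μ ((pathMeasure μ (Measure.dirac 1)).map limitConfig) ∧
      ¬ IsTrivialMeasure ((pathMeasure μ (Measure.dirac 1)).map limitConfig) ∧
      ¬ LiouvilleWalk μ := by
  refine ⟨limitConfig, measurable_limitConfig, ?_,
    ⟨boundaryConfig, isBoundaryMap_boundaryConfig hfin hnd, Eventually.of_forall fun x => rfl⟩,
    isMuBoundary_limitConfig hfin hnd, not_isTrivialMeasure_limitConfig hfin hnd, fun hL => ?_⟩
  · filter_upwards [ae_converges hfin hnd (Measure.dirac 1)] with x hx using hx.tendsto
  · refine not_isTrivialMeasure_limitConfig hfin hnd ?_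
    -- A trivial harmonic measure would have a trivial image under the boundary map.
    have := IsTrivialMeasure.map hL measurable_boundaryConfig
    rwa [harmonicMeasure, boundaryMeasure,
      Measure.map_map measurable_boundaryConfig measurable_bnd] at this
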